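/- Let $\mathcal B$ be a unital $C^*$-algebra, $E$ a (right) Hilbert $\mathcal B$-module, $\mathscr B^a(E)$ the $*$-algebra of adjointable operators on $E$, and $\xi\in E$ a unit vector, $\langle\xi,\xi\rangle=\mathbf 1$. For $x,y\in E$ write $xy^*$ for the operator $z\mapsto x\langle y,z\rangle$. Let $\vartheta=(\vartheta_t)_{t\ge 0}$ be a strict $E_0$-semigroup on $\mathscr B^a(E)$, that is, a semigroup ($\vartheta_0=\mathrm{id}$, $\vartheta_{s+t}=\vartheta_s\circ\vartheta_t$) of unital $*$-endomorphisms, each strictly continuous on bounded sets. Assume that $(E,\vartheta,\xi)$ is a white noise, i.e. $\langle\xi,\vartheta_t(a)\xi\rangle=\langle\xi,a\xi\rangle$ for all $a\in\mathscr B^a(E)$, $t\ge 0$. Let $E_t=\vartheta_t(\xi\xi^*)E$ with the inner product and the right action of $E$ and the left action $b\,y=\vartheta_t(\xi b\xi^*)y$ of $\mathcal B$ (the members of the product system of $\vartheta$), and identify $E\odot E_t$ with $E$ by $x\odot y=\vartheta_t(x\xi^*)y$. For $a\in\mathscr B^a(E_t)$ let $\xi\xi^*\odot a=(\xi\odot\mathrm{id})\,a\,(\xi^*\odot\mathrm{id})\in\mathscr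 B^a(E)$, where $\xi\odot\mathrm{id}\colon E_t\to E$, $y\mapsto\xi\odot y$, and $\xi^*\odot\mathrm{id}\colon E\to E_t$, $x\odot y\mapsto\langle\xi,x\rangle y$, is its adjoint. Put $$\breve{\mathcal A}_t=\xi\xi^*\odot\mathscr B^a(E_t)=\{\xi\xi^*\odot a:a\in\mathscr B^a(E_t)\},\qquad \breve{\mathcal A}_{[t,t+s]}=\vartheta_t(\breve{\mathcal A}_s),$$ and $\Phi(a)=\xi\langle\xi,a\xi\rangle\xi^*$ for $a\in\mathscr B^a(E)$. Let $0<r<s<t$. Then the ordered pair $(\breve{\mathcal A}_{[s,t]},\breve{\mathcal A}_{[r,s]})$ (future first) is conditionally monotone independent over $\breve{\mathcal A}_0$, where $\breve{\mathcal A}_0$ is regarded as contained in both algebras through $\vartheta_s$. Explicitly: (i) $\Phi$ is a conditional expectation of $\mathscr B^a(E)$ onto $\breve{\mathcal A}_0$; the restriction of $\vartheta_s$ to $\breve{\mathcal A}_0$ is injective and maps into $\breve{\mathcal A}_{[s,t]}\cap\breve{\mathcal A}_{[r,s]}$; and $\Phi(\vartheta_s(b))=b$, $\Phi(\vartheta_s(b)a)=b\,\Phi(a)$,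 $\Phi(a\,\vartheta_s(b))=\Phi(a)\,b$ for all $b\in\breve{\mathcal A}_0$, $a\in\mathscr B^a(E)$. For all $n\ge 1$, $f_0,\dots,f_n\in\breve{\mathcal A}_{[s,t]}$ and $g_1,\dots,g_n\in\breve{\mathcal A}_{[r,s]}$, $$\Phi(f_0g_1f_1\cdots g_nf_n)=\Phi(f_0)\;\Phi\bigl(g_1\,\vartheta_s(\Phi(f_1))\,g_2\cdots\vartheta_s(\Phi(f_{n-1}))\,g_n\bigr)\;\Phi(f_n).$$ (ii) Equivalently, in terms of the common subalgebra $\vartheta_s(\breve{\mathcal A}_0)$ of $\breve{\mathcal A}_{[s,t]}$ and $\breve{\mathcal A}_{[r,s]}$: $\Phi_s=\vartheta_s\circ\Phi$ is a conditional expectation of $\mathscr B^a(E)$ onto $\vartheta_s(\breve{\mathcal A}_0)$, and for all $n$, $f_i$, $g_i$ as above $$\Phi_s(f_0g_1f_1\cdots g_nf_n)=\Phi_s(f_0)\;\Phi_s\bigl(g_1\,\Phi_s(f_1)\,g_2\cdots\Phi_s(f_{n-1})\,g_n\bigr)\;\Phi_s(f_n).$$ -/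

import Mathlib

open scoped NNReal RightActions

set_option linter.unusedSectionVars false

namespace MonotoneNoise

/-! ## Right Hilbert modules and their adjointable operators

A right Hilbert module `E` over a `C*`-algebra `B` is a complete `CStarModule Bᵐᵒᵖ E`: then
`x <• b = MulOpposite.op b • x` is the right action, and the `B`-valued inner product `ip B x y`
satisfies `ip B x (y <• b) = ip B x y * b`. -/

section HilbertModule

instance instStarOrderedRingMop {B : Type*} [CStarAlgebra B] [PartialOrder B]
    [StarOrderedRing B] : StarOrderedRing Bᵐᵒᵖ := by
  refine StarOrderedRing.of_nonneg_iff' ?_ ?_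
  · intro x y h z
    change z.unop + x.unop ≤ z.unop + y.unop
    exact add_le_add_right (show x.unop ≤ y.unop from h) _
  · intro x
    change 0 ≤ x.unop ↔ _
    rw [CStarAlgebra.nonneg_iff_eq_mul_star_self]
    constructor
    · rintro ⟨s, hs⟩
      exact ⟨MulOpposite.op s, MulOpposite.unop_injective (by simpa using hs)⟩
    · rintro ⟨s, hs⟩
      exact ⟨s.unop, by simp [hs]⟩

variable (B : Type*) [CStarAlgebra B] [PartialOrder B] [StarOrderedRing B]
variable {E : Type*} [NormedAddCommGroup E] [NormedSpace ℂ E] [Module Bᵐᵒᵖ E]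
  [IsScalarTower ℂ Bᵐᵒᵖ E] [CStarModule Bᵐᵒᵖ E]

/-- The `B`-valued inner product of a right Hilbert `B`-module, linear in the second variable. -/
def ip (x y : E) : B := (inner Bᵐᵒᵖ x y).unop

lemma ip_add_right (x y z : E) : ip B x (y + z) = ip B x y + ip B x z := by simp [ip]
lemma ip_sub_right (x y z : E) : ip B x (y - z) = ip B x y - ip B x z := by simp [ip]
lemma ip_csmul_right (c : ℂ) (x y : E) : ip B x (c • y) = c • ip B x y := by simp [ip]
lemma ip_zero_right (x : E) : ip B x 0 = 0 := by simp [ip]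
lemma star_ip (x y : E) : star (ip B x y) = ip B y x := by
  rw [ip, ip, ← CStarModule.star_inner x y]; rfl
lemma ip_self_nonneg (x : E) : 0 ≤ ip B x x :=
  (CStarModule.inner_self_nonneg : (0 : Bᵐᵒᵖ) ≤ inner Bᵐᵒᵖ x x)
lemma ip_self_eq_zero (x : E) : ip B x x = 0 ↔ x = 0 := by
  rw [← CStarModule.inner_self (A := Bᵐᵒᵖ) (x := x), ip, MulOpposite.unop_eq_zero_iff]
lemma norm_ip_le (x y : E) : ‖ip B x y‖ ≤ ‖x‖ * ‖y‖ := CStarModule.norm_inner_le (A := Bᵐᵒᵖ) E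
lemma norm_sq_eq_ip (x : E) : ‖x‖ ^ 2 = ‖ip B x x‖ := CStarModule.norm_sq_eq Bᵐᵒᵖ

variable {B}

lemma ip_smul_right (x y : E) (b : B) : ip B x (y <• b) = ip B x y * b := by simp [ip]
lemma ip_smul_left (x y : E) (b : B) : ip B (x <• b) y = star b * ip B x y := by
  rw [← star_ip, ip_smul_right, star_mul, star_ip]
lemma norm_smul_le_mul (x : E) (b : B) : ‖x <• b‖ ≤ ‖b‖ * ‖x‖ := by
  refine abs_le_of_sq_le_sq' ?_ (by positivity) |>.2
  rw [norm_sq_eq_ip B, ip_smul_left, ip_smul_right, mul_pow, norm_sq_eq_ip B x]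
  calc ‖star b * (ip B x x * b)‖ ≤ ‖star b‖ * (‖ip B x x‖ * ‖b‖) :=
        (norm_mul_le _ _).trans (by gcongr; exact norm_mul_le _ _)
    _ = ‖b‖ ^ 2 * ‖ip B x x‖ := by rw [norm_star]; ring

variable (B)

lemma ext_ip {x y : E} (h : ∀ z, ip B z x = ip B z y) : x = y := by
  rw [← sub_eq_zero, ← ip_self_eq_zero B, ip_sub_right, h, sub_self]

variable (E)

/-- The adjointable operators on the Hilbert `B`-module `E`, as a subalgebra of the bounded
operators. -/
def adjointableOperators : Subalgebra ℂ (E →L[ℂ] E) where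
  carrier := {a | ∃ a' : E →L[ℂ] E, ∀ x y : E, ip B (a x) y = ip B x (a' y)}
  mul_mem' := by
    rintro a c ⟨a', ha⟩ ⟨c', hc⟩
    exact ⟨c' * a', fun x y => by simp [ha, hc]⟩
  add_mem' := by
    rintro a c ⟨a', ha⟩ ⟨c', hc⟩
    refine ⟨a' + c', fun x y => ?_⟩
    rw [← star_ip]
    simp only [_root_.add_apply, ip_add_right, star_add, star_ip, ha, hc]
  algebraMap_mem' r := by
    refine ⟨algebraMap ℂ _ (star r), fun x y => ?_⟩
    rw [← star_ip]
    simp only [Algebra.algebraMap_eq_smul_one, _root_.smul_apply,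
      one_apply_eq_self, ip_csmul_right, star_smul, star_ip]

/-- The algebra `𝓑ᵃ(E)` of all adjointable operators on the Hilbert `B`-module `E`, with the
operator norm. -/
def Ba : Type _ := ↥(adjointableOperators B E)

noncomputable instance : NormedRing (Ba B E) :=
  inferInstanceAs (NormedRing ↥(adjointableOperators B E))

noncomputable instance : NormedAlgebra ℂ (Ba B E) :=
  inferInstanceAs (NormedAlgebra ℂ ↥(adjointableOperators B E))

variable {B E}

/-- The bounded operator underlying an adjointable operator. -/
def Ba.toCLM (a : Ba B E) : E →L[ℂ] E := Subtype.val a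

/-- An operator with a given adjoint. -/
def Ba.mk (a a' : E →L[ℂ] E) (h : ∀ x y : E, ip B (a x) y = ip B x (a' y)) : Ba B E :=
  Subtype.mk a ⟨a', h⟩

lemma Ba.exists_adjoint (a : Ba B E) :
    ∃ a' : E →L[ℂ] E, ∀ x y : E, ip B (a.toCLM x) y = ip B x (a' y) := Subtype.property a

/-- The adjoint of an adjointable operator. -/
noncomputable instance : Star (Ba B E) where
  star a := Ba.mk a.exists_adjoint.choose a.toCLM fun x y => by
    rw [← star_ip, ← a.exists_adjoint.choose_spec, star_ip]

instance : FunLike (Ba B E) E E where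
  coe a := a.toCLM
  coe_injective _ _ h := Subtype.ext (DFunLike.coe_injective h)

lemma Ba.ext_apply {a c : Ba B E} (h : ∀ x, a x = c x) : a = c := DFunLike.ext _ _ h

lemma Ba.ip_left (a : Ba B E) (x y : E) : ip B (a x) y = ip B x (star a y) :=
  a.exists_adjoint.choose_spec x y
lemma Ba.ip_right (a : Ba B E) (x y : E) : ip B x (a y) = ip B (star a x) y := by
  rw [← star_ip, a.ip_left, star_ip]

lemma Ba.mul_apply (a c : Ba B E) (x : E) : (a * c) x = a (c x) := rfl
lemma Ba.one_apply (x : E) : (1 : Ba B E) x = x := rfl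
lemma Ba.zero_apply (x : E) : (0 : Ba B E) x = 0 := rfl
lemma Ba.add_apply (a c : Ba B E) (x : E) : (a + c) x = a x + c x := rfl
lemma Ba.csmul_apply (c : ℂ) (a : Ba B E) (x : E) : (c • a) x = c • a x := rfl
lemma Ba.map_add (a : Ba B E) (x y : E) : a (x + y) = a x + a y :=
  _root_.map_add a.toCLM x y
lemma Ba.map_zero (a : Ba B E) : a (0 : E) = 0 := _root_.map_zero a.toCLM
lemma Ba.map_csmul (a : Ba B E) (c : ℂ) (x : E) : a (c • x) = c • a x :=
  _root_.map_smul a.toCLM c x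
lemma Ba.map_smul (a : Ba B E) (x : E) (b : B) : a (x <• b) = a x <• b := by
  refine ext_ip B fun z => ?_
  rw [a.ip_right, ip_smul_right, ip_smul_right, a.ip_right]

lemma Ba.eq_star_of_ip {a c : Ba B E} (h : ∀ x y, ip B (a x) y = ip B x (c y)) : c = star a :=
  Ba.ext_apply fun y => ext_ip B fun x => by rw [← h, a.ip_left]

noncomputable instance : StarRing (Ba B E) where
  star_involutive a := (Ba.eq_star_of_ip fun x y => by rw [← Ba.ip_right]).symm
  star_mul a c := (Ba.eq_star_of_ip fun x y => by
    rw [Ba.mul_apply, Ba.mul_apply, a.ip_left, c.ip_left]).symm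
  star_add a c := (Ba.eq_star_of_ip fun x y => by
    rw [Ba.add_apply, Ba.add_apply, ip_add_right, ← star_ip, ip_add_right, star_add, star_ip,
      star_ip, a.ip_left, c.ip_left]).symm

instance : StarModule ℂ (Ba B E) where
  star_smul c a := (Ba.eq_star_of_ip fun x y => by
    rw [Ba.csmul_apply, Ba.csmul_apply, ip_csmul_right, ← star_ip, ip_csmul_right, star_smul,
      star_ip, a.ip_left]).symm

variable (B)

/-- The bounded operator `z ↦ x ⟨y, z⟩` on `E`. -/
noncomputable def rankOneCLM (x y : E) : E →L[ℂ] E :=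
  LinearMap.mkContinuous
    { toFun := fun z => x <• ip B y z
      map_add' := fun z w => by rw [ip_add_right, MulOpposite.op_add, add_smul]
      map_smul' := fun c z => by
        rw [ip_csmul_right, MulOpposite.op_smul, smul_assoc, RingHom.id_apply] }
    (‖y‖ * ‖x‖) fun z => (norm_smul_le_mul x _).trans (by
      calc ‖ip B y z‖ * ‖x‖ ≤ (‖y‖ * ‖z‖) * ‖x‖ := by gcongr; exact norm_ip_le B y z
        _ = ‖y‖ * ‖x‖ * ‖z‖ := by ring)

/-- The rank-one operator `x y* : z ↦ x ⟨y, z⟩` on `E`. -/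
noncomputable def rankOne (x y : E) : Ba B E :=
  Ba.mk (rankOneCLM B x y) (rankOneCLM B y x) fun z w => by
    change ip B (x <• ip B y z) w = ip B z (y <• ip B x w)
    rw [ip_smul_left, ip_smul_right, star_ip]

variable {B}

lemma rankOne_apply (x y z : E) : rankOne B x y z = x <• ip B y z := rfl

lemma star_rankOne (x y : E) : star (rankOne B x y) = rankOne B y x :=
  (Ba.eq_star_of_ip fun z w => by
    rw [rankOne_apply, rankOne_apply, ip_smul_left, ip_smul_right, star_ip]).symm

lemma mul_rankOne (a : Ba B E) (x y : E) : a * rankOne B x y = rankOne B (a x) y :=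
  Ba.ext_apply fun z => by rw [Ba.mul_apply, rankOne_apply, rankOne_apply, a.map_smul]

lemma rankOne_smul_mul_rankOne (x y z w : E) :
    rankOne B x y * rankOne B z w = rankOne B (x <• ip B y z) w := by
  rw [mul_rankOne, rankOne_apply]

variable (B E)

/-- The `*`-strong topology on `𝓑ᵃ(E)`: the topology of pointwise convergence on `E` of an operator
and its adjoint. On bounded sets it is the strict topology. -/
@[reducible]
noncomputable def starStrongTopology : TopologicalSpace (Ba B E) :=
  TopologicalSpace.induced (fun a (x : E) => (a x, star a x)) inferInstance

variable {B E}

/-- A map on `𝓑ᵃ(E)` is strict if it is strictly continuous on bounded sets. -/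
def IsStrict (φ : Ba B E → Ba B E) : Prop :=
  ∀ R : ℝ, @ContinuousOn _ _ (starStrongTopology B E) (starStrongTopology B E) φ {a | ‖a‖ ≤ R}

/-- A submodule of a Hilbert module, with the inner product of the ambient module. -/
noncomputable instance (S : Submodule Bᵐᵒᵖ E) : CStarModule Bᵐᵒᵖ S where
  inner x y := inner Bᵐᵒᵖ (x : E) (y : E)
  inner_add_right := CStarModule.inner_add_right
  inner_self_nonneg := CStarModule.inner_self_nonneg
  inner_self := CStarModule.inner_self.trans Submodule.coe_eq_zero
  inner_op_smul_right := CStarModule.inner_op_smul_right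
  inner_smul_right_complex := CStarModule.inner_smul_right_complex
  star_inner x y := CStarModule.star_inner (x : E) (y : E)
  norm_eq_sqrt_norm_inner_self x := CStarModule.norm_eq_sqrt_norm_inner_self (x : E)

lemma ip_coe {S : Submodule Bᵐᵒᵖ E} (x y : S) : ip B x y = ip B (x : E) (y : E) := rfl

end HilbertModule

/-! ## `E₀`-semigroups with a unit vector, and the associated product system -/

section ProductSystem

variable (B : Type*) [CStarAlgebra B] [PartialOrder B] [StarOrderedRing B]
variable (E : Type*) [NormedAddCommGroup E] [NormedSpace ℂ E] [Module Bᵐᵒᵖ E]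
  [IsScalarTower ℂ Bᵐᵒᵖ E] [CStarModule Bᵐᵒᵖ E]

/-- A triple `(E, ϑ, ξ)`: a strict `E₀`-semigroup `ϑ` (a semigroup of strict unital
`*`-endomorphisms) on `𝓑ᵃ(E)`, and a unit vector `ξ`, i.e. `⟨ξ, ξ⟩ = 1`. -/
structure E0Triple where
  ϑ : ℝ≥0 → (Ba B E →⋆ₐ[ℂ] Ba B E)
  ξ : E
  map_zero : ∀ a, ϑ 0 a = a
  map_add : ∀ s t a, ϑ (s + t) a = ϑ s (ϑ t a)
  strict : ∀ t, IsStrict (ϑ t)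
  unit : ip B ξ ξ = 1

namespace E0Triple

variable {B E} (N : E0Triple B E)

/-- `(E, ϑ, ξ)` is a white noise if `ϑ` leaves `⟨ξ, • ξ⟩` invariant. -/
def IsWhiteNoise : Prop := ∀ t a, ip B N.ξ (N.ϑ t a N.ξ) = ip B N.ξ (a N.ξ)

/-- The projection `ϑ_t(ξξ*)`. -/
noncomputable def proj (t : ℝ≥0) : Ba B E := N.ϑ t (rankOne B N.ξ N.ξ)

lemma proj_mul_self (t : ℝ≥0) : N.proj t * N.proj t = N.proj t := by
  rw [proj, ← _root_.map_mul, rankOne_smul_mul_rankOne, N.unit, MulOpposite.op_one, one_smul]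

lemma proj_apply_proj (t : ℝ≥0) (x : E) : N.proj t (N.proj t x) = N.proj t x := by
  rw [← Ba.mul_apply, proj_mul_self]

lemma star_proj (t : ℝ≥0) : star (N.proj t) = N.proj t := by
  rw [proj, ← map_star, star_rankOne]

/-- The member `E_t = ϑ_t(ξξ*) E` of the product system of `ϑ`, as a right Hilbert `B`-module. -/
def fiber (t : ℝ≥0) : Submodule Bᵐᵒᵖ E where
  carrier := Set.range (N.proj t)
  add_mem' := by
    rintro _ _ ⟨x, rfl⟩ ⟨y, rfl⟩
    exact ⟨x + y, Ba.map_add _ x y⟩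
  zero_mem' := ⟨0, Ba.map_zero _⟩
  smul_mem' := by
    rintro b _ ⟨x, rfl⟩
    exact ⟨x <• b.unop, Ba.map_smul _ x b.unop⟩

lemma proj_coe {t : ℝ≥0} (y : N.fiber t) : N.proj t y = y := by
  obtain ⟨x, hx⟩ := y.2
  rw [← hx, proj_apply_proj]

/-- The left action of `B` on `E_t`: `b y = ϑ_t(ξ b ξ*) y`. -/
noncomputable def leftAct {t : ℝ≥0} (b : B) (y : N.fiber t) : N.fiber t :=
  ⟨N.ϑ t (rankOne B (N.ξ <• b) N.ξ) y, N.ϑ t (rankOne B (N.ξ <• b) N.ξ) y, by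
    rw [← Ba.mul_apply, proj, ← _root_.map_mul, mul_rankOne, rankOne_apply, ip_smul_right, N.unit,
      one_mul]⟩

/-- The elementary tensor `x ⊙ y`, for `x ∈ E` and `y ∈ E_t`, in the canonical identification
`E ⊙ E_t = E`, `x ⊙ y = ϑ_t(x ξ*) y`. -/
noncomputable def tmul {t : ℝ≥0} (x : E) (y : N.fiber t) : E := N.ϑ t (rankOne B x N.ξ) y

/-- The identification is isometric: `⟨x ⊙ y, x' ⊙ y'⟩ = ⟨y, ⟨x, x'⟩ y'⟩`. -/
lemma ip_tmul {t : ℝ≥0} (x x' : E) (y y' : N.fiber t) :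
    ip B (N.tmul x y) (N.tmul x' y') = ip B y (N.leftAct (ip B x x') y') := by
  rw [ip_coe, tmul, tmul, leftAct, Ba.ip_left, ← map_star, star_rankOne, ← Ba.mul_apply,
    ← _root_.map_mul, rankOne_smul_mul_rankOne]

/-- In this identification `ϑ_t(a) = a ⊙ id`. -/
lemma map_apply_tmul {t : ℝ≥0} (a : Ba B E) (x : E) (y : N.fiber t) :
    N.ϑ t a (N.tmul x y) = N.tmul (a x) y := by
  rw [tmul, tmul, ← Ba.mul_apply, ← _root_.map_mul, mul_rankOne]

lemma tmul_ξ {t : ℝ≥0} (y : N.fiber t) : N.tmul N.ξ y = y := N.proj_coe y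

/-- The operator `ξ* ⊙ id : E = E ⊙ E_t → E_t`, which is the adjoint of `ξ ⊙ id : y ↦ ξ ⊙ y`. -/
noncomputable def coTmul (t : ℝ≥0) (z : E) : N.fiber t := ⟨N.proj t z, z, rfl⟩

lemma ip_tmul_ξ {t : ℝ≥0} (y : N.fiber t) (z : E) :
    ip B (N.tmul N.ξ y) z = ip B y (N.coTmul t z) := by
  rw [tmul_ξ, ip_coe, coTmul, Ba.ip_right, star_proj, proj_coe]

/-- `(ξ* ⊙ id)(x ⊙ y) = ⟨ξ, x⟩ y`. -/
lemma coTmul_tmul {t : ℝ≥0} (x : E) (y : N.fiber t) :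
    N.coTmul t (N.tmul x y) = N.leftAct (ip B N.ξ x) y := by
  apply Subtype.ext
  change N.ϑ t (rankOne B N.ξ N.ξ) (N.ϑ t (rankOne B x N.ξ) y)
    = N.ϑ t (rankOne B (N.ξ <• ip B N.ξ x) N.ξ) y
  rw [← Ba.mul_apply, ← _root_.map_mul, rankOne_smul_mul_rankOne]

lemma coTmul_coe {t : ℝ≥0} (y : N.fiber t) : N.coTmul t y = y := Subtype.ext (N.proj_coe y)

/-- The operator `ξ ⊙ id : E_t → E`, as a bounded operator. -/
noncomputable def tmulCLM (t : ℝ≥0) : N.fiber t →L[ℂ] E :=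
  LinearMap.mkContinuous
    { toFun := fun y => N.tmul N.ξ y
      map_add' := fun y y' => by rw [tmul_ξ, tmul_ξ, tmul_ξ, Submodule.coe_add]
      map_smul' := fun c y => by
        rw [tmul_ξ, tmul_ξ, Submodule.coe_smul_of_tower, RingHom.id_apply] }
    1 fun y => by
      change ‖N.tmul N.ξ y‖ ≤ _
      rw [tmul_ξ, one_mul]
      rfl

/-- The operator `ξ* ⊙ id : E → E_t`, as a bounded operator. -/
noncomputable def coTmulCLM (t : ℝ≥0) : E →L[ℂ] N.fiber t :=
  (N.proj t).toCLM.codRestrict ((N.fiber t).restrictScalars ℂ) fun z => ⟨z, rfl⟩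

/-- The operator `ξξ* ⊙ a = (ξ ⊙ id) a (ξ* ⊙ id)` on `E = E ⊙ E_t`, for `a ∈ 𝓑ᵃ(E_t)`. -/
noncomputable def corner {t : ℝ≥0} (a : Ba B (N.fiber t)) : Ba B E :=
  Ba.mk ((N.tmulCLM t).comp (a.toCLM.comp (N.coTmulCLM t)))
    ((N.tmulCLM t).comp ((star a).toCLM.comp (N.coTmulCLM t))) fun x y => by
      change ip B (N.tmul N.ξ (a (N.coTmul t x))) y
        = ip B x (N.tmul N.ξ (star a (N.coTmul t y)))
      rw [ip_tmul_ξ, ← star_ip B _ x, ip_tmul_ξ, star_ip, Ba.ip_left]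

lemma corner_apply {t : ℝ≥0} (a : Ba B (N.fiber t)) (z : E) :
    N.corner a z = N.tmul N.ξ (a (N.coTmul t z)) := rfl

/-- `(ξξ* ⊙ a)(x ⊙ y) = ξ ⊙ a ⟨ξ, x⟩ y`. -/
lemma corner_tmul {t : ℝ≥0} (a : Ba B (N.fiber t)) (x : E) (y : N.fiber t) :
    N.corner a (N.tmul x y) = N.tmul N.ξ (a (N.leftAct (ip B N.ξ x) y)) := by
  rw [corner_apply, coTmul_tmul]

/-- The `*`-homomorphism `a ↦ ξξ* ⊙ a` from `𝓑ᵃ(E_t)` to `𝓑ᵃ(E)`. -/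
noncomputable def cornerHom (t : ℝ≥0) : Ba B (N.fiber t) →⋆ₙₐ[ℂ] Ba B E where
  toFun a := N.corner a
  map_smul' c a := Ba.ext_apply fun z => by
    rw [MonoidHom.id_apply, corner_apply, Ba.csmul_apply, Ba.csmul_apply, corner_apply, tmul_ξ,
      tmul_ξ, Submodule.coe_smul_of_tower]
  map_zero' := Ba.ext_apply fun z => by
    rw [corner_apply, tmul_ξ]; rfl
  map_add' a c := Ba.ext_apply fun z => by
    rw [corner_apply, Ba.add_apply, Ba.add_apply, corner_apply, corner_apply, tmul_ξ, tmul_ξ,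
      tmul_ξ, Submodule.coe_add]
  map_mul' a c := Ba.ext_apply fun z => by
    rw [corner_apply, Ba.mul_apply, Ba.mul_apply, corner_apply, corner_apply, tmul_ξ _ (c _),
      coTmul_coe]
  map_star' a := Ba.eq_star_of_ip fun x y => by
    rw [corner_apply, corner_apply, ip_tmul_ξ, ← star_ip B _ x, ip_tmul_ξ, star_ip, Ba.ip_left]

/-- The filtration `Ă_t = ξξ* ⊙ 𝓑ᵃ(E_t)`. -/
noncomputable def filtration (t : ℝ≥0) : NonUnitalStarSubalgebra ℂ (Ba B E) :=
  NonUnitalStarAlgHom.range (N.cornerHom t)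

/-- The algebra `Ă_[r, s] = ϑ_r(Ă_{s - r})` of the interval `[r, s]`, for `r ≤ s`. -/
noncomputable def increment (r s : ℝ≥0) : NonUnitalStarSubalgebra ℂ (Ba B E) :=
  (N.filtration (s - r)).map (N.ϑ r)

/-- The operator `y ↦ (ξ* ⊙ id) c (ξ ⊙ y)` on `E_t`. -/
noncomputable def compress (t : ℝ≥0) (c : Ba B E) : Ba B (N.fiber t) :=
  Ba.mk ((N.coTmulCLM t).comp (c.toCLM.comp (N.tmulCLM t)))
    ((N.coTmulCLM t).comp ((star c).toCLM.comp (N.tmulCLM t))) fun x y => by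
      change ip B (N.coTmul t (c (N.tmul N.ξ x))) y = ip B x (N.coTmul t (star c (N.tmul N.ξ y)))
      rw [← ip_tmul_ξ, ← star_ip, ← ip_tmul_ξ, star_ip, Ba.ip_left]

lemma mem_filtration {t : ℝ≥0} {c : Ba B E} (hc : N.proj t * c * N.proj t = c) :
    c ∈ N.filtration t := by
  refine ⟨N.compress t c, Ba.ext_apply fun z => ?_⟩
  change N.tmul N.ξ (N.coTmul t (c (N.tmul N.ξ (N.coTmul t z)))) = c z
  rw [tmul_ξ, tmul_ξ]
  exact congrArg (fun f : Ba B E => f z) hc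

/-- The conditional expectation `a ↦ ξ ⟨ξ, a ξ⟩ ξ*` from `𝓑ᵃ(E)` to `Ă_0`. -/
noncomputable def condExp : Ba B E →ₗ[ℂ] N.filtration 0 where
  toFun a := ⟨rankOne B (N.ξ <• ip B N.ξ (a N.ξ)) N.ξ, N.mem_filtration (by
    have hξ : rankOne B N.ξ N.ξ N.ξ = N.ξ := by
      rw [rankOne_apply, N.unit, MulOpposite.op_one, one_smul]
    rw [proj, N.map_zero, mul_assoc, rankOne_smul_mul_rankOne, N.unit, MulOpposite.op_one,
      one_smul, mul_rankOne, Ba.map_smul, hξ])⟩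
  map_add' a c := Subtype.ext <| Ba.ext_apply fun z => by
    simp only [NonUnitalStarSubalgebra.coe_add, Ba.add_apply, rankOne_apply, ip_add_right,
      MulOpposite.op_add, add_smul, smul_add]
  map_smul' c a := Subtype.ext <| Ba.ext_apply fun z => by
    simp only [NonUnitalStarSubalgebra.coe_smul, Ba.csmul_apply, rankOne_apply, ip_csmul_right,
      MulOpposite.op_smul, RingHom.id_apply, smul_assoc]
    rw [← smul_one_smul Bᵐᵒᵖ c (N.ξ <• _), ← smul_one_smul Bᵐᵒᵖ c (_ • _), smul_smul, smul_smul,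
      smul_smul, smul_smul]
    simp

/-- The copy `ϑ_s(Ă_0)` of `Ă_0`. -/
noncomputable def shiftedBase (s : ℝ≥0) : NonUnitalStarSubalgebra ℂ (Ba B E) :=
  (N.filtration 0).map (N.ϑ s)

/-- The isomorphism `ϑ_s : Ă_0 → ϑ_s(Ă_0)`, with values in `𝓑ᵃ(E)`. -/
noncomputable def baseEmbedding (s : ℝ≥0) : N.filtration 0 →⋆ₙₐ[ℂ] Ba B E :=
  (N.ϑ s : Ba B E →⋆ₙₐ[ℂ] Ba B E).comp (NonUnitalStarSubalgebraClass.subtype (N.filtration 0))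

/-- The map `a ↦ ϑ_s(ξ ⟨ξ, a ξ⟩ ξ*)` from `𝓑ᵃ(E)` to `ϑ_s(Ă_0)`. -/
noncomputable def shiftedCondExp (s : ℝ≥0) : Ba B E →ₗ[ℂ] N.shiftedBase s where
  toFun a := ⟨N.baseEmbedding s (N.condExp a), N.condExp a, (N.condExp a).2, rfl⟩
  map_add' a c := Subtype.ext <|
    (congrArg (N.baseEmbedding s) (_root_.map_add N.condExp a c)).trans
      (_root_.map_add (N.baseEmbedding s) _ _)
  map_smul' c a := Subtype.ext <|
    (congrArg (N.baseEmbedding s) (_root_.map_smul N.condExp c a)).trans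
      (_root_.map_smul (N.baseEmbedding s) c _)

end E0Triple

end ProductSystem

/-! ## Conditional monotone independence -/

section Independence

variable {A : Type*} [Ring A] [StarRing A] [Algebra ℂ A] [StarModule ℂ A]
variable {A₀ : NonUnitalStarSubalgebra ℂ A}

/-- `Φ` is a conditional expectation of the `*`-algebra `A` onto its `*`-subalgebra `A₀`. -/
structure IsConditionalExpectation (Φ : A →ₗ[ℂ] A₀) : Prop where
  apply_coe : ∀ b : A₀, Φ b = b
  map_coe_mul : ∀ (b : A₀) (a : A), Φ (b * a) = b * Φ a
  map_mul_coe : ∀ (a : A) (b : A₀), Φ (a * b) = Φ a * b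
  map_star : ∀ a : A, Φ (star a) = star (Φ a)
  map_nonneg : ∀ a : A,
    Φ (star a * a) ∈ AddSubmonoid.closure (Set.range fun c : A₀ => star c * c)

/-- The moment formula
`Φ(a₁⁽⁰⁾ a₂⁽¹⁾ a₁⁽¹⁾ ⋯ a₂⁽ⁿ⁾ a₁⁽ⁿ⁾) = Φ(a₁⁽⁰⁾) Φ(a₂⁽¹⁾ Φ(a₁⁽¹⁾) a₂⁽²⁾ ⋯ Φ(a₁⁽ⁿ⁻¹⁾) a₂⁽ⁿ⁾) Φ(a₁⁽ⁿ⁾)`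
for `n = m + 1 ≥ 1`, where `A₀` is regarded as contained in `A₁` and `A₂` through `j`. -/
def MonotoneFormula (Φ : A →ₗ[ℂ] A₀) (j : A₀ →⋆ₙₐ[ℂ] A)
    (A₁ A₂ : NonUnitalStarSubalgebra ℂ A) : Prop :=
  ∀ (m : ℕ) (a₁ a₂ : ℕ → A), (∀ i, a₁ i ∈ A₁) → (∀ i, a₂ i ∈ A₂) →
    Φ (a₁ 0 * ((List.range (m + 1)).map fun i => a₂ (i + 1) * a₁ (i + 1)).prod) =
      Φ (a₁ 0) *
        Φ (a₂ 1 * ((List.range m).map fun i => j (Φ (a₁ (i + 1))) * a₂ (i + 2)).prod) *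
        Φ (a₁ (m + 1))

/-- The ordered pair `(A₁, A₂)` of `*`-subalgebras of `A`, both containing `A₀`, is conditionally
monotone independent over `A₀` in the conditional expectation `Φ`. -/
structure CondMonotoneIndep (Φ : A →ₗ[ℂ] A₀) (A₁ A₂ : NonUnitalStarSubalgebra ℂ A) : Prop where
  condExp : IsConditionalExpectation Φ
  le_left : A₀ ≤ A₁
  le_right : A₀ ≤ A₂
  formula : MonotoneFormula Φ (NonUnitalStarSubalgebraClass.subtype A₀) A₁ A₂

/-- The same notion when `A₀` is contained in `A₁` and `A₂` not literally but through an embedding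
`j` that is compatible with `Φ`: `j` is an injective `*`-homomorphism into `A₁ ∩ A₂`, it is a right
inverse of `Φ`, and `Φ` is a bimodule map also for the copy `j(A₀)`. -/
structure CondMonotoneIndepVia (Φ : A →ₗ[ℂ] A₀) (j : A₀ →⋆ₙₐ[ℂ] A)
    (A₁ A₂ : NonUnitalStarSubalgebra ℂ A) : Prop where
  condExp : IsConditionalExpectation Φ
  injective : Function.Injective j
  mem_left : ∀ b, j b ∈ A₁
  mem_right : ∀ b, j b ∈ A₂
  apply_embedding : ∀ b, Φ (j b) = b
  map_embedding_mul : ∀ b a, Φ (j b * a) = b * Φ a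
  map_mul_embedding : ∀ a b, Φ (a * j b) = Φ a * b
  formula : MonotoneFormula Φ j A₁ A₂

end Independence

end MonotoneNoise

namespace MonotoneNoise

/-! ### Alternating products in a monoid -/

section Products

variable {A : Type*} [Monoid A]

/-! Write `p = ξξ*` and `q = ϑ_s(p)`. Everything reduces to computing with these two projections:
`Φ(a) = p a p`, and `Ă_t` is the corner of `𝓑ᵃ(E)` cut out by `ϑ_t(p)` (`mem_filtration_iff`). Past
elements `g ∈ Ă_[r, s]` therefore satisfy `q g q = g`, while future elements `f = ϑ_s(c)` satisfy `q
f q = ϑ_s(p c p) = ϑ_s(Φ(f))`, the last equality by invariance of the vacuum. Each `f` between two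
`g`s is thus replaced by `ϑ_s(Φ(f))`, and so are the outer two once the whole word is compressed by
`q`.

This outer compression is invisible to `Φ`, because in a white noise `p q = p = q p`. More generally
`ϑ_s(b) p = b = p ϑ_s(b)` for `b ∈ Ă_0` (`baseEmbedding_mul_vacuumProj`), so the outer factors
`ϑ_s(Φ(f))` can be pulled out of `Φ` as `Φ(f)`. This gives the moment formula for `Φ`; applying the
homomorphism `ϑ_s` to it gives the one for `Φ_s`. -/

/-- An alternating product that starts and ends with a `g i`. -/
lemma alternating_prod_mul_of_mul {q : A} {g : ℕ → A} (hg : ∀ i, g i * q = g i) (k : ℕ → A)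
    (m : ℕ) :
    g 1 * ((List.range m).map fun i => k (i + 1) * g (i + 2)).prod * q =
      g 1 * ((List.range m).map fun i => k (i + 1) * g (i + 2)).prod := by
  cases m with
  | zero => simp [hg]
  | succ m => simp [List.range_succ, mul_assoc, hg]

/-- If the `g i` live in the corner of `q`, then in an alternating product all factors `f i` but the
last one may be compressed by `q`. -/
lemma mul_alternating_prod {q : A} {f g k : ℕ → A} (hl : ∀ i, q * g i = g i)
    (hr : ∀ i, g i * q = g i) (hf : ∀ i, q * f i * q = k i) (m : ℕ) :
    q * (f 0 * ((List.range (m + 1)).map fun i => g (i + 1) * f (i + 1)).prod) =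
      k 0 * (g 1 * ((List.range m).map fun i => k (i + 1) * g (i + 2)).prod) * f (m + 1) := by
  induction m with
  | zero =>
    have h : q * (g 1 * f 1) = g 1 * f 1 := by rw [← mul_assoc, hl]
    simp [← hf, mul_assoc, h]
  | succ m ih =>
    rw [List.range_succ, List.map_append, List.prod_append, ← mul_assoc (f 0), ← mul_assoc q, ih,
      ← alternating_prod_mul_of_mul hr k m, List.range_succ, List.map_append, List.prod_append,
      ← mul_assoc (g 1), ← alternating_prod_mul_of_mul hr k m]
    simp only [List.map_cons, List.map_nil, List.prod_singleton]
    -- The `q` on the left of `f (m + 1)` was split off the preceding product, the one on its right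
    -- comes from `g (m + 2)`. Idempotence of `q` is not assumed, so the `q`s to the left of `f (m +
    -- 1)` must agree in number on both sides; those in front of `g (m + 2)` are absorbed.
    rw [← hf (m + 1), ← hl (m + 2)]
    simp only [mul_assoc]
    simp only [← mul_assoc q q, ← mul_assoc q (g (m + 2)), hl]

end Products

/-! ### The vacuum projection, its shifts and their corners -/

section Operators

variable {B : Type*} [CStarAlgebra B] [PartialOrder B] [StarOrderedRing B]
variable {E : Type*} [NormedAddCommGroup E] [NormedSpace ℂ E] [Module Bᵐᵒᵖ E]
  [IsScalarTower ℂ Bᵐᵒᵖ E] [CStarModule Bᵐᵒᵖ E]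

lemma Ba.eq_zero_of_star_mul_self {x : Ba B E} (h : star x * x = 0) : x = 0 :=
  Ba.ext_apply fun z => by
    rw [Ba.zero_apply, ← ip_self_eq_zero B, Ba.ip_left, ← Ba.mul_apply, h, Ba.zero_apply,
      ip_zero_right]

namespace E0Triple

variable (N : E0Triple B E)

/-- The projection `ξξ*`. -/
noncomputable def vacuumProj : Ba B E := rankOne B N.ξ N.ξ

lemma vacuumProj_mul_self : N.vacuumProj * N.vacuumProj = N.vacuumProj := by
  rw [vacuumProj, rankOne_smul_mul_rankOne, N.unit, MulOpposite.op_one, one_smul]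

lemma star_vacuumProj : star N.vacuumProj = N.vacuumProj := star_rankOne _ _

lemma proj_eq (t : ℝ≥0) : N.proj t = N.ϑ t N.vacuumProj := rfl

lemma proj_zero : N.proj 0 = N.vacuumProj := N.map_zero _

lemma map_proj (s t : ℝ≥0) : N.ϑ s (N.proj t) = N.proj (s + t) := (N.map_add s t _).symm

lemma vacuumProj_mul_mul (a : Ba B E) :
    N.vacuumProj * a * N.vacuumProj = rankOne B (N.ξ <• ip B N.ξ (a N.ξ)) N.ξ := by
  rw [mul_assoc, vacuumProj, mul_rankOne, rankOne_smul_mul_rankOne]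

lemma coe_condExp (a : Ba B E) : (N.condExp a : Ba B E) = N.vacuumProj * a * N.vacuumProj :=
  (N.vacuumProj_mul_mul a).symm

/-- The maps `ξ ⊙ id` and `ξ* ⊙ id` are the inclusion of `E_t` and the projection onto it, so `ξξ* ⊙
a` is `a` extended by zero. From here on tensor products are replaced by corners of projections. -/
lemma mem_filtration_iff {t : ℝ≥0} {c : Ba B E} :
    c ∈ N.filtration t ↔ N.proj t * c * N.proj t = c := by
  refine ⟨?_, N.mem_filtration⟩
  rintro ⟨a, rfl⟩
  refine Ba.ext_apply fun z => ?_
  change N.proj t (N.corner a (N.proj t z)) = N.corner a z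
  rw [corner_apply, corner_apply, tmul_ξ, tmul_ξ, proj_coe]
  exact congrArg (fun y => ((a y : N.fiber t) : E)) (N.coTmul_coe (N.coTmul t z))

lemma vacuumProj_mul_coe (b : N.filtration 0) : N.vacuumProj * (b : Ba B E) = b := by
  have h := N.mem_filtration_iff.1 b.2
  rw [proj_zero] at h
  rw [← h, ← mul_assoc, ← mul_assoc, vacuumProj_mul_self]

lemma coe_mul_vacuumProj (b : N.filtration 0) : (b : Ba B E) * N.vacuumProj = b := by
  have h := N.mem_filtration_iff.1 b.2
  rw [proj_zero] at h
  rw [← h, mul_assoc, vacuumProj_mul_self]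

lemma baseEmbedding_apply (s : ℝ≥0) (b : N.filtration 0) :
    N.baseEmbedding s b = N.ϑ s b := rfl

lemma coe_shiftedCondExp (s : ℝ≥0) (a : Ba B E) :
    (N.shiftedCondExp s a : Ba B E) = N.baseEmbedding s (N.condExp a) := rfl

/-- Positivity descends to `B`: `⟨ξ, a*a ξ⟩ = ⟨aξ, aξ⟩` has the form `b*b`, and then `c = ξ b ξ*`
works because `⟨ξ, ξ⟩ = 1`. -/
lemma condExp_nonneg (a : Ba B E) :
    ∃ c : N.filtration 0, N.condExp (star a * a) = star c * c := by
  have h : 0 ≤ ip B N.ξ ((star a * a) N.ξ) := by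
    rw [Ba.mul_apply, ← Ba.ip_left]
    exact ip_self_nonneg B _
  obtain ⟨b, hb⟩ := CStarAlgebra.nonneg_iff_eq_star_mul_self.1 h
  refine ⟨⟨rankOne B (N.ξ <• b) N.ξ, N.mem_filtration ?_⟩, Subtype.ext ?_⟩
  · have hu : N.vacuumProj * rankOne B (N.ξ <• b) N.ξ = rankOne B (N.ξ <• b) N.ξ := by
      rw [vacuumProj, rankOne_smul_mul_rankOne, ip_smul_right, N.unit, one_mul]
    rw [proj_zero, hu, vacuumProj, rankOne_smul_mul_rankOne, N.unit, MulOpposite.op_one, one_smul]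
  · change rankOne B (N.ξ <• ip B N.ξ ((star a * a) N.ξ)) N.ξ
      = star (rankOne B (N.ξ <• b) N.ξ) * rankOne B (N.ξ <• b) N.ξ
    rw [hb, star_rankOne, rankOne_smul_mul_rankOne, ip_smul_left, ip_smul_right, N.unit, one_mul]

lemma isConditionalExpectation_condExp : IsConditionalExpectation N.condExp where
  apply_coe b := Subtype.ext <| by rw [coe_condExp, vacuumProj_mul_coe, coe_mul_vacuumProj]
  map_coe_mul b a := Subtype.ext <| by
    rw [NonUnitalStarSubalgebra.coe_mul, coe_condExp, coe_condExp, ← mul_assoc N.vacuumProj,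
      vacuumProj_mul_coe, ← mul_assoc, ← mul_assoc, coe_mul_vacuumProj]
  map_mul_coe a b := Subtype.ext <| by
    rw [NonUnitalStarSubalgebra.coe_mul, coe_condExp, coe_condExp, mul_assoc, mul_assoc,
      coe_mul_vacuumProj, mul_assoc _ N.vacuumProj, vacuumProj_mul_coe, mul_assoc]
  map_star a := Subtype.ext <| by
    change _ = star (N.condExp a : Ba B E)
    rw [coe_condExp, coe_condExp, star_mul, star_mul, star_vacuumProj, mul_assoc]
  map_nonneg a := by
    obtain ⟨c, hc⟩ := N.condExp_nonneg a
    rw [hc]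
    exact AddSubmonoid.subset_closure ⟨c, rfl⟩

/-- Elements of `Ă_[r, s]` live in the corner of `ϑ_s(ξξ*)`. -/
lemma proj_mul_mul_of_mem_increment {r s : ℝ≥0} (hrs : r ≤ s) {g : Ba B E}
    (hg : g ∈ N.increment r s) : N.proj s * g * N.proj s = g := by
  obtain ⟨c, hc, rfl⟩ := hg
  have h : N.proj s = N.ϑ r (N.proj (s - r)) := by rw [map_proj, add_tsub_cancel_of_le hrs]
  change N.proj s * N.ϑ r c * N.proj s = N.ϑ r c
  rw [h, ← _root_.map_mul, ← _root_.map_mul, N.mem_filtration_iff.1 hc]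

lemma proj_mul_of_mem_increment {r s : ℝ≥0} (hrs : r ≤ s) {g : Ba B E}
    (hg : g ∈ N.increment r s) : N.proj s * g = g := by
  rw [← N.proj_mul_mul_of_mem_increment hrs hg, ← mul_assoc, ← mul_assoc, proj_mul_self]

lemma mul_proj_of_mem_increment {r s : ℝ≥0} (hrs : r ≤ s) {g : Ba B E}
    (hg : g ∈ N.increment r s) : g * N.proj s = g := by
  rw [← N.proj_mul_mul_of_mem_increment hrs hg, mul_assoc, proj_mul_self]

/-! ### Consequences of the invariance of the vacuum -/

variable {N}

lemma condExp_map (hN : N.IsWhiteNoise) (t : ℝ≥0) (a : Ba B E) :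
    N.condExp (N.ϑ t a) = N.condExp a := by
  refine Subtype.ext ?_
  rw [coe_condExp, coe_condExp, vacuumProj_mul_mul, vacuumProj_mul_mul, hN]

lemma condExp_baseEmbedding (hN : N.IsWhiteNoise) (t : ℝ≥0) (b : N.filtration 0) :
    N.condExp (N.baseEmbedding t b) = b := by
  rw [baseEmbedding_apply, condExp_map hN, N.isConditionalExpectation_condExp.apply_coe]

lemma vacuumProj_mul_map_mul (hN : N.IsWhiteNoise) (t : ℝ≥0) (a : Ba B E) :
    N.vacuumProj * N.ϑ t a * N.vacuumProj = N.vacuumProj * a * N.vacuumProj := by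
  rw [← coe_condExp, ← coe_condExp, condExp_map hN]

/-- In a white noise, `ϑ_t` does not change the action of `Ă_0` on the vacuum. -/
lemma baseEmbedding_mul_vacuumProj (hN : N.IsWhiteNoise) (t : ℝ≥0) (b : N.filtration 0) :
    N.baseEmbedding t b * N.vacuumProj = b := by
  have hl := N.vacuumProj_mul_coe b
  have hr := N.coe_mul_vacuumProj b
  have hs : star (b : Ba B E) * N.vacuumProj = star (b : Ba B E) := by
    conv_rhs => rw [← hl, star_mul, star_vacuumProj]
  have hs' : N.vacuumProj * star (b : Ba B E) = star (b : Ba B E) := by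
    conv_rhs => rw [← hr, star_mul, star_vacuumProj]
  rw [baseEmbedding_apply, ← sub_eq_zero]
  apply Ba.eq_zero_of_star_mul_self
  -- With `x = ϑ_t(b) p - b`, the square `x*x` expands into four terms, each equal up to sign to
  -- `b*b`. This one uses multiplicativity of `ϑ_t` and invariance; the two mixed terms use only
  -- invariance and `b = p b p`.
  have h₁ : N.vacuumProj * N.ϑ t (star (b : Ba B E)) * (N.ϑ t b * N.vacuumProj)
      = star (b : Ba B E) * b := by
    rw [mul_assoc, ← mul_assoc (N.ϑ t _), ← _root_.map_mul, ← mul_assoc,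
      vacuumProj_mul_map_mul hN, ← mul_assoc, hs', mul_assoc, hr]
  have h₂ : N.vacuumProj * N.ϑ t (star (b : Ba B E)) * b = star (b : Ba B E) * b := by
    nth_rewrite 2 [← hl]
    rw [← mul_assoc, vacuumProj_mul_map_mul hN, hs', hs]
  have h₃ : star (b : Ba B E) * (N.ϑ t b * N.vacuumProj) = star (b : Ba B E) * b := by
    conv_lhs => rw [← hs, mul_assoc, ← mul_assoc N.vacuumProj, vacuumProj_mul_map_mul hN, hl, hr]
  rw [star_sub, star_mul, star_vacuumProj, ← map_star, sub_mul, mul_sub, mul_sub, h₁, h₂, h₃]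
  abel

lemma vacuumProj_mul_baseEmbedding (hN : N.IsWhiteNoise) (t : ℝ≥0) (b : N.filtration 0) :
    N.vacuumProj * N.baseEmbedding t b = b := by
  have h := congrArg star (baseEmbedding_mul_vacuumProj hN t (star b))
  rw [star_mul, star_vacuumProj, map_star, star_star] at h
  exact h.trans (star_star (b : Ba B E))

lemma proj_mul_vacuumProj (hN : N.IsWhiteNoise) (t : ℝ≥0) :
    N.proj t * N.vacuumProj = N.vacuumProj :=
  baseEmbedding_mul_vacuumProj hN t ⟨N.vacuumProj, N.mem_filtration (by
    rw [proj_zero, vacuumProj_mul_self, vacuumProj_mul_self])⟩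

lemma vacuumProj_mul_proj (hN : N.IsWhiteNoise) (t : ℝ≥0) :
    N.vacuumProj * N.proj t = N.vacuumProj := by
  have h := congrArg star (proj_mul_vacuumProj hN t)
  rwa [star_mul, star_vacuumProj, star_proj] at h

/-- Invariance gives `p ≤ ϑ_{t-s}(p)`, so the corner `Ă_0` lies in the corner `Ă_{t-s}`; then shift
by `s`. -/
lemma baseEmbedding_mem_increment_left (hN : N.IsWhiteNoise) (s t : ℝ≥0) (b : N.filtration 0) :
    N.baseEmbedding s b ∈ N.increment s t := by
  refine ⟨b, N.mem_filtration ?_, rfl⟩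
  rw [← N.vacuumProj_mul_coe b, ← mul_assoc, proj_mul_vacuumProj hN, vacuumProj_mul_coe,
    ← N.coe_mul_vacuumProj b, mul_assoc, vacuumProj_mul_proj hN]

/-- Here the semigroup law suffices: `ϑ_s(b) = ϑ_r(ϑ_{s-r}(b))`, and `ϑ_{s-r}` carries the corner of
`p` into that of `ϑ_{s-r}(p)`. -/
lemma baseEmbedding_mem_increment_right {r s : ℝ≥0} (hrs : r ≤ s) (b : N.filtration 0) :
    N.baseEmbedding s b ∈ N.increment r s := by
  refine ⟨N.ϑ (s - r) b, N.mem_filtration ?_, ?_⟩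
  · rw [proj_eq, ← _root_.map_mul, ← _root_.map_mul, vacuumProj_mul_coe, coe_mul_vacuumProj]
  · change N.ϑ r (N.ϑ (s - r) b) = N.ϑ s b
    rw [← N.map_add, add_tsub_cancel_of_le hrs]

lemma condExp_baseEmbedding_mul (hN : N.IsWhiteNoise) (s : ℝ≥0) (b : N.filtration 0)
    (a : Ba B E) : N.condExp (N.baseEmbedding s b * a) = b * N.condExp a :=
  Subtype.ext <| by
    rw [NonUnitalStarSubalgebra.coe_mul, coe_condExp, coe_condExp, ← mul_assoc N.vacuumProj,
      vacuumProj_mul_baseEmbedding hN, ← mul_assoc, ← mul_assoc, coe_mul_vacuumProj]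

lemma condExp_mul_baseEmbedding (hN : N.IsWhiteNoise) (s : ℝ≥0) (a : Ba B E)
    (b : N.filtration 0) : N.condExp (a * N.baseEmbedding s b) = N.condExp a * b :=
  Subtype.ext <| by
    rw [NonUnitalStarSubalgebra.coe_mul, coe_condExp, coe_condExp, mul_assoc, mul_assoc,
      baseEmbedding_mul_vacuumProj hN, mul_assoc _ N.vacuumProj, vacuumProj_mul_coe, mul_assoc]

/-- This is how conditional expectations appear inside a word: compressing a future factor by `q =
ϑ_s(p)` is the shifted image of compressing its preimage by `p`. -/
lemma proj_mul_mul_proj_of_mem_increment (hN : N.IsWhiteNoise) {s t : ℝ≥0} {f : Ba B E}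
    (hf : f ∈ N.increment s t) :
    N.proj s * f * N.proj s = N.baseEmbedding s (N.condExp f) := by
  obtain ⟨c, -, rfl⟩ := hf
  change N.proj s * N.ϑ s c * N.proj s = N.baseEmbedding s (N.condExp (N.ϑ s c))
  rw [condExp_map hN, baseEmbedding_apply, coe_condExp, _root_.map_mul, _root_.map_mul, proj_eq]

/-- Since `p q = p = q p`, the compression by `p` factors through the one by `q`. -/
lemma condExp_eq_of_proj_mul_eq (hN : N.IsWhiteNoise) (s : ℝ≥0) {a c : Ba B E}
    (h : N.proj s * a * N.proj s = N.proj s * c * N.proj s) : N.condExp a = N.condExp c :=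
  Subtype.ext <| by
    have key : ∀ x, N.vacuumProj * x * N.vacuumProj =
        N.vacuumProj * (N.proj s * x * N.proj s) * N.vacuumProj := fun x => by
      rw [mul_assoc (N.proj s), ← mul_assoc N.vacuumProj, vacuumProj_mul_proj hN, mul_assoc,
        mul_assoc N.vacuumProj, mul_assoc x, proj_mul_vacuumProj hN]
    rw [coe_condExp, coe_condExp, key a, h, ← key c]

/-! ### The moment formula and the two forms of independence -/

lemma monotoneFormula_condExp (hN : N.IsWhiteNoise) {r s : ℝ≥0} (hrs : r ≤ s) (t : ℝ≥0) :
    MonotoneFormula N.condExp (N.baseEmbedding s) (N.increment s t) (N.increment r s) := by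
  intro m f g hf hg
  have hl := fun i => N.proj_mul_of_mem_increment hrs (hg i)
  have hr := fun i => N.mul_proj_of_mem_increment hrs (hg i)
  have hk := fun i => proj_mul_mul_proj_of_mem_increment hN (hf i)
  have hq : ∀ x, N.proj s * (N.proj s * x) = N.proj s * x := fun x => by
    rw [← mul_assoc, proj_mul_self]
  -- Move the outer factors inside `Φ` as elements of `ϑ_s(Ă_0)`, so that both sides are `Φ` of a
  -- single word and it is enough to compare their compressions by `q`.
  rw [← condExp_baseEmbedding_mul hN s (N.condExp (f 0)),
    ← condExp_mul_baseEmbedding hN s _ (N.condExp (f (m + 1)))]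
  apply condExp_eq_of_proj_mul_eq hN s
  -- The last factor is still uncompressed: its right `q` is the outer one, and its left `q` is
  -- split off the preceding `g`.
  rw [mul_alternating_prod hl hr hk, ← hk (m + 1), ← hk 0,
    ← alternating_prod_mul_of_mul hr (fun i => N.baseEmbedding s (N.condExp (f i))) m]
  simp only [mul_assoc, N.proj_mul_self, hq]

lemma condMonotoneIndepVia_condExp (hN : N.IsWhiteNoise) {r s : ℝ≥0} (hrs : r ≤ s) (t : ℝ≥0) :
    CondMonotoneIndepVia N.condExp (N.baseEmbedding s) (N.increment s t) (N.increment r s) where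
  condExp := N.isConditionalExpectation_condExp
  injective := Function.LeftInverse.injective (condExp_baseEmbedding hN s)
  mem_left := baseEmbedding_mem_increment_left hN s t
  mem_right := baseEmbedding_mem_increment_right hrs
  apply_embedding := condExp_baseEmbedding hN s
  map_embedding_mul := condExp_baseEmbedding_mul hN s
  map_mul_embedding := condExp_mul_baseEmbedding hN s
  formula := monotoneFormula_condExp hN hrs t

/-- Every element of the range is some `ϑ_s(b)`, so the axioms are the images under `ϑ_s` of
properties of `Φ`; for the bimodule rules these are the ones over the copy `ϑ_s(Ă_0)`, not over
`Ă_0`. -/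
lemma isConditionalExpectation_shiftedCondExp (hN : N.IsWhiteNoise) (s : ℝ≥0) :
    IsConditionalExpectation (N.shiftedCondExp s) where
  apply_coe := by
    rintro ⟨_, b, hb, rfl⟩
    exact Subtype.ext (congrArg (N.baseEmbedding s) (condExp_baseEmbedding hN s ⟨b, hb⟩))
  map_coe_mul := by
    rintro ⟨_, b, hb, rfl⟩ a
    exact Subtype.ext ((congrArg (N.baseEmbedding s)
      (condExp_baseEmbedding_mul hN s ⟨b, hb⟩ a)).trans (_root_.map_mul (N.baseEmbedding s) _ _))
  map_mul_coe := by
    rintro a ⟨_, b, hb, rfl⟩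
    exact Subtype.ext ((congrArg (N.baseEmbedding s)
      (condExp_mul_baseEmbedding hN s a ⟨b, hb⟩)).trans (_root_.map_mul (N.baseEmbedding s) _ _))
  map_star a := Subtype.ext <|
    (congrArg (N.baseEmbedding s) (N.isConditionalExpectation_condExp.map_star a)).trans
      (map_star (N.baseEmbedding s) _)
  map_nonneg a := by
    obtain ⟨c, hc⟩ := N.condExp_nonneg a
    refine AddSubmonoid.subset_closure ⟨⟨N.baseEmbedding s c, c, c.2, rfl⟩, Subtype.ext ?_⟩
    rw [coe_shiftedCondExp, hc, _root_.map_mul, map_star]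
    rfl

lemma condMonotoneIndep_shiftedCondExp (hN : N.IsWhiteNoise) {r s : ℝ≥0} (hrs : r ≤ s)
    (t : ℝ≥0) :
    CondMonotoneIndep (N.shiftedCondExp s) (N.increment s t) (N.increment r s) where
  condExp := isConditionalExpectation_shiftedCondExp hN s
  le_left := by
    rintro _ ⟨b, hb, rfl⟩
    exact baseEmbedding_mem_increment_left hN s t ⟨b, hb⟩
  le_right := by
    rintro _ ⟨b, hb, rfl⟩
    exact baseEmbedding_mem_increment_right hrs ⟨b, hb⟩
  formula m f g hf hg := Subtype.ext <| by
    -- The inner factors `ϑ_s(Φ(f i))` are already `Φ_s(f i)` by definition, so only the outer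
    -- products have to be mapped.
    have h := congrArg (N.baseEmbedding s) (monotoneFormula_condExp hN hrs t m f g hf hg)
    rw [_root_.map_mul (N.baseEmbedding s), _root_.map_mul (N.baseEmbedding s)] at h
    exact h

end E0Triple

end Operators

end MonotoneNoise

theorem mainTheorem2 {B : Type*} [CStarAlgebra B] [PartialOrder B] [StarOrderedRing B]
    {E : Type*} [NormedAddCommGroup E] [NormedSpace ℂ E] [CompleteSpace E]
    [Module Bᵐᵒᵖ E] [IsScalarTower ℂ Bᵐᵒᵖ E] [CStarModule Bᵐᵒᵖ E]
    (N : MonotoneNoise.E0Triple B E) (hN : N.IsWhiteNoise)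
    (r s t : ℝ≥0) (hr : 0 < r) (hrs : r < s) (hst : s < t) :
    MonotoneNoise.CondMonotoneIndepVia N.condExp (N.baseEmbedding s)
        (N.increment s t) (N.increment r s) ∧
      MonotoneNoise.CondMonotoneIndep (N.shiftedCondExp s)
        (N.increment s t) (N.increment r s) := by
  exact ⟨MonotoneNoise.E0Triple.condMonotoneIndepVia_condExp hN hrs.le t,
    MonotoneNoise.E0Triple.condMonotoneIndep_shiftedCondExp hN hrs.le t⟩
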